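/- Let $\mathbb D=\{z\in\mathbb C:|z|<1\}$ and let $\mathcal S$ be the class of univalent analytic functions $f$ on $\mathbb D$ with $f(0)=0$, $f'(0)=1$; write $f(z)=z+\sum_{n=2}^\infty a_nz^n$. For $0<s\le 1/\sqrt2$ let $\mathcal{ST}_L(s)$ be the class of all $f\in\mathcal S$ such that $zf'(z)/f(z)$ (taken to be $1$ at $z=0$) is subordinate to $\phi(z)=(1+sz)^2$, i.e. equals $\phi(\omega(z))$ on $\mathbb D$ for some analytic $\omega:\mathbb D\to\mathbb D$ with $\omega(0)=0$. Let $0.444981<s\le 1/\sqrt2$ and $h(z)=z\exp\!\left(s\left(2z+\tfrac{s z^2}{2}\right)\right)$. Then $h\in\mathcal{ST}_L(s)$ and $zh'(z)/h(z)=\phi(z)$ on $\mathbb D$. The equation $h(r)+h(-1)=0$ has a root in $(0,1)$, and its smallest root $r_f$ in $(0,1)$ satisfies $0<r_f<1/3$. For every $f\in\mathcal{ST}_L(s)$, $$|z|+\sum_{n=2}^{\infty}|a_n|\,|z|^n\le d\bigl(f(0),\partial f(\mathbb D)\bigr)\qquad\text{for } |z|\le r_f,$$ where $d$ is the Euclidean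 distance. The radius $r_f$ is best possible: for every $r\in(r_f,1)$ there is $f\in\mathcal{ST}_L(s)$ such that the inequality fails for all $z$ with $|z|=r$. -/

import Mathlib

noncomputable section

namespace BohrStarlike

/-- The open unit disk of the complex plane. -/
def disk : Set ℂ := Metric.ball 0 1

/-- The class `𝒮` of normalized univalent functions on the unit disk
(values outside the disk are irrelevant). -/
def classS : Set (ℂ → ℂ) :=
  {f | DifferentiableOn ℂ f disk ∧ Set.InjOn f disk ∧ f 0 = 0 ∧ deriv f 0 = 1}

/-- Subordination `f ≺ g` in the unit disk: `f = g ∘ ω` there, for an analytic self-map `ω` of the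
disk with `ω 0 = 0`. -/
def Subordinate (f g : ℂ → ℂ) : Prop :=
  ∃ ω : ℂ → ℂ, DifferentiableOn ℂ ω disk ∧ Set.MapsTo ω disk disk ∧ ω 0 = 0 ∧
    ∀ z ∈ disk, f z = g (ω z)

/-- The function `z ↦ z f'(z) / f(z)`, with its removable singularity at `0` filled in by the
value `1` (which is the limit for normalized `f`). -/
def logDerivQuot (f : ℂ → ℂ) : ℂ → ℂ :=
  Function.update (fun z => z * deriv f z / f z) 0 1

/-- The Ma-Minda starlike class `𝒮*(φ)`. -/
def starlikeClass (φ : ℂ → ℂ) : Set (ℂ → ℂ) :=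
  {f | f ∈ classS ∧ Subordinate (logDerivQuot f) φ}

/-- The function `φ(z) = (1 + s z)²`. -/
def phiL (s : ℝ) (z : ℂ) : ℂ := (1 + (s : ℂ) * z) ^ 2

/-- The class `𝒮𝒯_L(s) = 𝒮*((1 + s z)²)`. -/
def classSTL (s : ℝ) : Set (ℂ → ℂ) := starlikeClass (phiL s)

/-- The function `h(z) = z exp (s (2 z + s z² / 2))`. -/
def hL (s : ℝ) (z : ℂ) : ℂ :=
  z * Complex.exp ((s : ℂ) * (2 * z + (s : ℂ) * z ^ 2 / 2))

/-- The `n`-th Taylor coefficient of `f` at the origin. -/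
def taylorCoeff (f : ℂ → ℂ) (n : ℕ) : ℂ := iteratedDeriv n f 0 / (n.factorial : ℂ)

/-- The majorant sum `r + ∑_{n ≥ 2} |a_n| r^n` of `f(z) = z + ∑_{n ≥ 2} a_n z^n`. -/
def majorant (f : ℂ → ℂ) (r : ℝ) : ℝ :=
  r + ∑' n : ℕ, ‖taylorCoeff f (n + 2)‖ * r ^ (n + 2)

/-- The Euclidean distance `d(f(0), ∂f(𝔻))`. -/
def boundaryDist (f : ℂ → ℂ) : ℝ := Metric.infDist (f 0) (frontier (f '' disk))

end BohrStarlike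

end

noncomputable section

namespace BohrStarlike

open Metric Set Filter Topology

/-! Write `f z = z * F z`. Subordination becomes the linear equation `F' = F * Q` with `Q = 2 s g +
s² z g²`, where `g z = ω z / z` is bounded by 1 (Schwarz). Let `M` denote the majorant series.

Upper side: `M` is submultiplicative, and Bohr's theorem gives `M g ≤ 1` on `[0, 1/3]`. Hence `M Q ≤
2 s + s² r`, and since `(M F)' = M F'`, a Grönwall argument yields `M f (r) ≤ h(r)` for `r ≤ 1/3`.

Lower side: the growth bound `|f z| ≥ |z| exp(-2 s |z| + s² |z|² / 2)` places the boundary of the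
image at distance at least `-h(-1)` from 0.

The two sides meet at the root of `h(r) = -h(-1)`, and the lower bound on `s` is what puts this root
below `1/3`. Sharpness comes from `h` itself: `h(-1)` is a boundary point of its image and `M h (r)
≥ h(r)`. -/

lemma isOpen_disk : IsOpen disk := isOpen_ball

lemma mem_disk {z : ℂ} : z ∈ disk ↔ ‖z‖ < 1 := mem_ball_zero_iff

lemma zero_mem_disk : (0 : ℂ) ∈ disk := by simp [mem_disk]

lemma disk_mem_nhds {z : ℂ} (hz : z ∈ disk) : disk ∈ 𝓝 z := isOpen_disk.mem_nhds hz

/-! ### Taylor coefficients and majorant series -/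

/-- The majorant series `∑ |a_n| r^n` of the Taylor series of `f` at the origin. -/
def majorantSum (f : ℂ → ℂ) (r : ℝ) : ℝ := ∑' n : ℕ, ‖taylorCoeff f n‖ * r ^ n

lemma hasSum_taylorCoeff {f : ℂ → ℂ} (hf : DifferentiableOn ℂ f disk) {z : ℂ} (hz : z ∈ disk) :
    HasSum (fun n => taylorCoeff f n * z ^ n) (f z) := by
  have h := Complex.hasSum_taylorSeries_on_ball (c := 0) (r := 1) hf hz
  convert! h using 2 with n
  simp only [taylorCoeff, smul_eq_mul, sub_zero]
  ring

lemma summable_norm_taylorCoeff {f : ℂ → ℂ} (hf : DifferentiableOn ℂ f disk) {r : ℝ}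
    (h0 : 0 ≤ r) (h1 : r < 1) : Summable fun n => ‖taylorCoeff f n‖ * r ^ n := by
  have hz : (r : ℂ) ∈ disk := by simpa [mem_disk, abs_of_nonneg h0]
  have h := (hasSum_taylorCoeff hf hz).summable.norm
  simpa [abs_of_nonneg h0] using h

lemma taylorCoeff_congr {f g : ℂ → ℂ} (h : EqOn f g disk) (n : ℕ) :
    taylorCoeff f n = taylorCoeff g n := by
  have : f =ᶠ[𝓝 0] g := by
    filter_upwards [disk_mem_nhds zero_mem_disk] with z hz using h hz
  simp only [taylorCoeff, this.iteratedDeriv_eq]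

lemma majorantSum_congr {f g : ℂ → ℂ} (h : EqOn f g disk) (r : ℝ) :
    majorantSum f r = majorantSum g r := by
  simp only [majorantSum, taylorCoeff_congr h]

lemma contDiffAt_zero {f : ℂ → ℂ} (hf : DifferentiableOn ℂ f disk) (n : ℕ) :
    ContDiffAt ℂ n f 0 :=
  (hf.analyticAt (disk_mem_nhds zero_mem_disk)).contDiffAt

lemma taylorCoeff_zero (f : ℂ → ℂ) : taylorCoeff f 0 = f 0 := by simp [taylorCoeff]

lemma taylorCoeff_one (f : ℂ → ℂ) : taylorCoeff f 1 = deriv f 0 := by simp [taylorCoeff]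

lemma taylorCoeff_mul {f g : ℂ → ℂ} (hf : DifferentiableOn ℂ f disk)
    (hg : DifferentiableOn ℂ g disk) (n : ℕ) :
    taylorCoeff (fun z => f z * g z) n =
      ∑ i ∈ Finset.range (n + 1), taylorCoeff f i * taylorCoeff g (n - i) := by
  simp only [taylorCoeff]
  rw [iteratedDeriv_fun_mul (contDiffAt_zero hf n) (contDiffAt_zero hg n), Finset.sum_div]
  refine Finset.sum_congr rfl fun i hi => ?_
  have hin : i ≤ n := Nat.lt_succ_iff.mp (Finset.mem_range.mp hi)
  have h1 : ((n.choose i : ℕ) : ℂ) * i.factorial * (n - i).factorial = n.factorial := by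
    exact_mod_cast Nat.choose_mul_factorial_mul_factorial hin
  have h2 : (n.choose i : ℂ) ≠ 0 := by exact_mod_cast (Nat.choose_pos hin).ne'
  have h3 : (i.factorial : ℂ) ≠ 0 := by exact_mod_cast i.factorial_ne_zero
  have h4 : ((n - i).factorial : ℂ) ≠ 0 := by exact_mod_cast (n - i).factorial_ne_zero
  rw [← h1]
  field_simp

lemma taylorCoeff_add {f g : ℂ → ℂ} (hf : DifferentiableOn ℂ f disk)
    (hg : DifferentiableOn ℂ g disk) (n : ℕ) :
    taylorCoeff (fun z => f z + g z) n = taylorCoeff f n + taylorCoeff g n := by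
  simp only [taylorCoeff]
  rw [iteratedDeriv_fun_add (contDiffAt_zero hf n) (contDiffAt_zero hg n), add_div]

lemma taylorCoeff_const_mul (c : ℂ) (f : ℂ → ℂ) (n : ℕ) :
    taylorCoeff (fun z => c * f z) n = c * taylorCoeff f n := by
  simp only [taylorCoeff]
  rw [iteratedDeriv_const_mul_field, mul_div_assoc]

lemma taylorCoeff_id (n : ℕ) : taylorCoeff (fun z => z) n = if n = 1 then 1 else 0 := by
  rcases n with _ | _ | n
  · simp [taylorCoeff]
  · simp [taylorCoeff]
  · simp [taylorCoeff, iteratedDeriv_succ']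

lemma taylorCoeff_deriv (f : ℂ → ℂ) (n : ℕ) :
    taylorCoeff (deriv f) n = (n + 1) * taylorCoeff f (n + 1) := by
  have h2 : (n.factorial : ℂ) ≠ 0 := by exact_mod_cast n.factorial_ne_zero
  have h3 : (n + 1 : ℂ) ≠ 0 := by exact_mod_cast n.succ_ne_zero
  simp only [taylorCoeff, iteratedDeriv_succ', Nat.factorial_succ, Nat.cast_mul, Nat.cast_add,
    Nat.cast_one]
  field_simp

lemma taylorCoeff_id_mul {f : ℂ → ℂ} (hf : DifferentiableOn ℂ f disk) (n : ℕ) :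
    taylorCoeff (fun z => z * f z) (n + 1) = taylorCoeff f n := by
  rw [taylorCoeff_mul (f := fun z => z) differentiableOn_id hf]
  simp only [taylorCoeff_id, ite_mul, one_mul, zero_mul]
  simp

lemma majorantSum_nonneg (f : ℂ → ℂ) {r : ℝ} (h0 : 0 ≤ r) : 0 ≤ majorantSum f r :=
  tsum_nonneg fun n => by positivity

lemma norm_le_majorantSum {f : ℂ → ℂ} (hf : DifferentiableOn ℂ f disk) {z : ℂ} (hz : z ∈ disk) :
    ‖f z‖ ≤ majorantSum f ‖z‖ := by
  rw [← (hasSum_taylorCoeff hf hz).tsum_eq]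
  refine (norm_tsum_le_tsum_norm ?_).trans_eq ?_
  · exact (hasSum_taylorCoeff hf hz).summable.norm
  · simp [majorantSum]

/-- Cauchy product and the triangle inequality. This carries `F' = F * Q` over to an inequality
between majorants. -/
lemma majorantSum_mul_le {f g : ℂ → ℂ} (hf : DifferentiableOn ℂ f disk)
    (hg : DifferentiableOn ℂ g disk) {r : ℝ} (h0 : 0 ≤ r) (h1 : r < 1) :
    majorantSum (fun z => f z * g z) r ≤ majorantSum f r * majorantSum g r := by
  have hF := summable_norm_taylorCoeff hf h0 h1
  have hG := summable_norm_taylorCoeff hg h0 h1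
  have key := hasSum_sum_range_mul_of_summable_norm hF.norm hG.norm
  rw [majorantSum, majorantSum, majorantSum, ← key.tsum_eq]
  refine (summable_norm_taylorCoeff (hf.mul hg) h0 h1).tsum_le_tsum (fun n => ?_) key.summable
  change ‖taylorCoeff (fun z => f z * g z) n‖ * r ^ n ≤ _
  rw [taylorCoeff_mul hf hg]
  refine (mul_le_mul_of_nonneg_right (norm_sum_le _ _) (by positivity)).trans_eq ?_
  rw [Finset.sum_mul]
  refine Finset.sum_congr rfl fun i hi => ?_
  have hin : i ≤ n := Nat.lt_succ_iff.mp (Finset.mem_range.mp hi)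
  have hr : r ^ n = r ^ i * r ^ (n - i) := by rw [← pow_add, Nat.add_sub_cancel' hin]
  rw [norm_mul, hr]
  ring

lemma majorantSum_add_le {f g : ℂ → ℂ} (hf : DifferentiableOn ℂ f disk)
    (hg : DifferentiableOn ℂ g disk) {r : ℝ} (h0 : 0 ≤ r) (h1 : r < 1) :
    majorantSum (fun z => f z + g z) r ≤ majorantSum f r + majorantSum g r := by
  have hF := summable_norm_taylorCoeff hf h0 h1
  have hG := summable_norm_taylorCoeff hg h0 h1
  rw [majorantSum, majorantSum, majorantSum, ← hF.tsum_add hG]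
  refine (summable_norm_taylorCoeff (hf.add hg) h0 h1).tsum_le_tsum (fun n => ?_) (hF.add hG)
  change ‖taylorCoeff (fun z => f z + g z) n‖ * r ^ n ≤ _
  rw [taylorCoeff_add hf hg, ← add_mul]
  gcongr
  exact norm_add_le _ _

lemma majorantSum_const_mul (c : ℂ) (f : ℂ → ℂ) (r : ℝ) :
    majorantSum (fun z => c * f z) r = ‖c‖ * majorantSum f r := by
  simp only [majorantSum, taylorCoeff_const_mul, norm_mul, mul_assoc, tsum_mul_left]

lemma majorantSum_id (r : ℝ) : majorantSum (fun z => z) r = r := by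
  rw [majorantSum, tsum_eq_single 1]
  · simp [taylorCoeff_id]
  · intro n hn
    simp [taylorCoeff_id, hn]

/-- Termwise differentiation, dominated on a slightly larger interval of radius `ρ`. It makes the
coefficientwise bound on `F'` a differential inequality for the majorant of `F`. -/
lemma hasDerivAt_majorantSum {f : ℂ → ℂ} (hf : DifferentiableOn ℂ f disk) {r : ℝ}
    (hr : |r| < 1) : HasDerivAt (majorantSum f) (majorantSum (deriv f) r) r := by
  obtain ⟨ρ, hrρ, hρ1⟩ := exists_between hr
  have hρ0 : 0 ≤ ρ := (abs_nonneg r).trans hrρ.le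
  have hd := summable_norm_taylorCoeff (hf.deriv isOpen_disk) hρ0 hρ1
  have hcoef (n : ℕ) : ‖taylorCoeff (deriv f) n‖ = (n + 1) * ‖taylorCoeff f (n + 1)‖ := by
    rw [taylorCoeff_deriv, norm_mul]
    congr 1
    exact_mod_cast Complex.norm_natCast (n + 1)
  have hu : Summable fun n : ℕ => ‖taylorCoeff f n‖ * (n * ρ ^ (n - 1)) := by
    rw [← summable_nat_add_iff 1]
    refine hd.congr fun n => ?_
    rw [hcoef, Nat.add_sub_cancel]
    push_cast
    ring
  have key := hasDerivAt_tsum_of_isPreconnected (t := ball (0 : ℝ) ρ) (y₀ := 0) (y := r)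
    (g := fun n x => ‖taylorCoeff f n‖ * x ^ n)
    (g' := fun n x => ‖taylorCoeff f n‖ * (n * x ^ (n - 1))) hu isOpen_ball
    (convex_ball _ _).isPreconnected
    (fun n y _ => (hasDerivAt_pow n y).const_mul _) ?_ (mem_ball_self ((abs_nonneg r).trans_lt hrρ))
    (summable_norm_taylorCoeff hf le_rfl one_pos) (by simpa using hrρ)
  · convert! key using 1
    rw [majorantSum]
    have hs : Summable fun n : ℕ => ‖taylorCoeff f n‖ * (n * r ^ (n - 1)) := by
      refine .of_norm_bounded hu fun n => ?_
      rw [norm_mul, norm_norm, norm_mul, norm_pow, Real.norm_natCast, Real.norm_eq_abs]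
      gcongr
    rw [hs.tsum_eq_zero_add]
    simp only [CharP.cast_eq_zero, zero_mul, mul_zero, zero_add, Nat.add_sub_cancel]
    refine tsum_congr fun n => ?_
    rw [hcoef]
    push_cast
    ring
  · intro n y hy
    rw [mem_ball_zero_iff] at hy
    rw [norm_mul, norm_norm, norm_mul, norm_pow, Real.norm_natCast]
    gcongr

/-! ### Carathéodory's inequality and Bohr's theorem -/

/-- The coefficient inequality of Carathéodory: the Taylor coefficients of a function with
nonnegative real part are bounded by twice its real part at the origin. -/
lemma norm_taylorCoeff_le_of_re_nonneg {p : ℂ → ℂ} (hp : DifferentiableOn ℂ p disk)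
    (hre : ∀ z ∈ disk, 0 ≤ (p z).re) {n : ℕ} (hn : n ≠ 0) :
    ‖taylorCoeff p n‖ ≤ 2 * (p 0).re := by
  have main : ∀ ρ : ℝ, 0 < ρ → ρ < 1 → ρ ^ n * ‖taylorCoeff p n‖ ≤ 2 * (p 0).re := by
    intro ρ hρ0 hρ1
    have hsub : closedBall (0 : ℂ) ρ ⊆ disk := closedBall_subset_ball hρ1
    have hpc : DifferentiableOn ℂ p (closedBall 0 ρ) := hp.mono hsub
    have hpcont : ContinuousOn p (sphere 0 ρ) := hpc.continuousOn.mono sphere_subset_closedBall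
    obtain ⟨η, hη, hηp⟩ : ∃ η : ℂ, ‖η‖ = 1 ∧ η * taylorCoeff p n = -‖taylorCoeff p n‖ := by
      by_cases h : taylorCoeff p n = 0
      · exact ⟨1, by simp [h]⟩
      · refine ⟨-‖taylorCoeff p n‖ / taylorCoeff p n, ?_, ?_⟩
        · simp [h]
        · field_simp
    set c : ℂ := ρ ^ n * η with hc
    have hsph : ∀ z ∈ sphere (0 : ℂ) ρ, z ≠ 0 := by
      intro z hz h
      simp [h] at hz
      exact hρ0.ne hz
    have avg1 : Real.circleAverage p 0 ρ = p 0 := by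
      refine DiffContOnCl.circleAverage (DifferentiableOn.diffContOnCl ?_)
      rw [abs_of_pos hρ0, closure_ball _ hρ0.ne']
      exact hpc
    have avg2 : Real.circleAverage (fun z => p z / z ^ n) 0 ρ = taylorCoeff p n := by
      rw [Real.circleAverage_eq_circleIntegral hρ0.ne']
      have h := hpc.circleIntegral_one_div_sub_center_pow_smul hρ0 n
      have h' : (∮ z in C(0, ρ), (z - 0)⁻¹ • (p z / z ^ n)) =
          ∮ z in C(0, ρ), (1 / (z - 0) ^ (n + 1)) • p z := by
        congr 1
        ext z
        simp only [sub_zero, smul_eq_mul, pow_succ]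
        ring
      rw [h', h, taylorCoeff, smul_eq_mul, smul_eq_mul]
      have := Complex.two_pi_I_ne_zero
      field_simp
    have avg3 : Real.circleAverage (fun z => z ^ n * p z) 0 ρ = 0 := by
      have : DifferentiableOn ℂ (fun z => z ^ n * p z) (closedBall 0 ρ) :=
        (differentiableOn_id.pow n).mul hpc
      rw [DiffContOnCl.circleAverage (DifferentiableOn.diffContOnCl ?_)]
      · simp [hn]
      · rwa [abs_of_pos hρ0, closure_ball _ hρ0.ne']
    have int1 : CircleIntegrable p 0 ρ := hpcont.circleIntegrable hρ0.le
    have cont2 : ContinuousOn (fun z => p z / z ^ n) (sphere 0 ρ) :=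
      hpcont.div (continuousOn_id.pow n) fun z hz => pow_ne_zero n (hsph z hz)
    have int2 : CircleIntegrable (fun z => p z / z ^ n) 0 ρ := cont2.circleIntegrable hρ0.le
    have cont3 : ContinuousOn (fun z => z ^ n * p z) (sphere 0 ρ) :=
      (continuousOn_id.pow n).mul hpcont
    have int3 : CircleIntegrable (fun z => z ^ n * p z) 0 ρ := cont3.circleIntegrable hρ0.le
    set c' : ℂ := (starRingEnd ℂ) η / ρ ^ n with hc'
    -- On the circle `G = (2 + 2 Re u) p` with `u = η (ρ / z)^n` unimodular, so its real part is
    -- nonnegative. Its mean is `2 p(0) - ρ^n |a_n|`: `η` was chosen to rotate `a_n` onto the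
    -- negative axis, and `z^n p` has mean 0.
    let G : ℂ → ℂ := fun z => (2 • p z + c • (p z / z ^ n)) + c' • (z ^ n * p z)
    have int1' : CircleIntegrable (fun z => 2 • p z) 0 ρ :=
      (hpcont.const_smul 2).circleIntegrable hρ0.le
    have int2' : CircleIntegrable (fun z => c • (p z / z ^ n)) 0 ρ :=
      (cont2.const_smul c).circleIntegrable hρ0.le
    have int3' : CircleIntegrable (fun z => c' • (z ^ n * p z)) 0 ρ :=
      (cont3.const_smul c').circleIntegrable hρ0.le
    have int12 : CircleIntegrable (fun z => 2 • p z + c • (p z / z ^ n)) 0 ρ := int1'.add int2'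
    have hGint : CircleIntegrable G 0 ρ := int12.add int3'
    have avgG : Real.circleAverage G 0 ρ = 2 * p 0 - ρ ^ n * ‖taylorCoeff p n‖ := by
      have e1 : Real.circleAverage (fun z => 2 • p z) 0 ρ = 2 * p 0 := by
        have : (fun z => 2 • p z) = fun z => (2 : ℂ) • p z := by ext z; simp
        rw [this, Real.circleAverage_fun_smul, avg1, smul_eq_mul]
      rw [Real.circleAverage_fun_add int12 int3',
        Real.circleAverage_fun_add int1' int2', Real.circleAverage_fun_smul,
        Real.circleAverage_fun_smul, avg2, avg3, e1, hc, smul_eq_mul, mul_assoc, hηp]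
      simp
      ring
    have hpos : 0 ≤ Real.circleAverage (Complex.reCLM ∘ G) 0 ρ := by
      refine Real.circleAverage_nonneg_of_nonneg fun z hz => ?_
      rw [abs_of_pos hρ0] at hz
      have hz0 := hsph z hz
      have hzn : ‖z‖ = ρ := by simpa using hz
      have hpz := hre z (hsub (sphere_subset_closedBall hz))
      set u : ℂ := η * (ρ / z) ^ n with hu
      have hun : ‖u‖ = 1 := by
        rw [hu, norm_mul, hη, norm_pow, norm_div, hzn, Complex.norm_real, Real.norm_eq_abs,
          abs_of_pos hρ0, div_self hρ0.ne', one_pow, one_mul]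
      have hconj : (starRingEnd ℂ) u = (starRingEnd ℂ) η * (z / ρ) ^ n := by
        rw [hu, map_mul, map_pow, map_div₀, Complex.conj_ofReal]
        congr 2
        have hz' : (starRingEnd ℂ) z ≠ 0 := by simpa using hz0
        have hρc : (ρ : ℂ) ≠ 0 := by exact_mod_cast hρ0.ne'
        rw [div_eq_div_iff hz' hρc, Complex.mul_conj, Complex.normSq_eq_norm_sq, hzn]
        push_cast
        ring
      have hGz : G z = ((2 + 2 * u.re : ℝ) : ℂ) * p z := by
        have : G z = (2 + (u + (starRingEnd ℂ) u)) * p z := by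
          rw [hconj, hu]
          simp only [G, hc, hc']
          simp only [smul_eq_mul, nsmul_eq_mul, Nat.cast_ofNat, div_pow]
          ring
        rw [this, Complex.add_conj]
        push_cast
        ring
      have hure : -1 ≤ u.re := by
        have := Complex.abs_re_le_norm u
        rw [hun] at this
        exact (abs_le.mp this).1
      simp only [Function.comp, Complex.reCLM_apply, hGz, Complex.re_ofReal_mul]
      exact mul_nonneg (by linarith) hpz
    rw [ContinuousLinearMap.circleAverage_comp_comm _ hGint, avgG] at hpos
    have e : Complex.reCLM (2 * p 0 - ρ ^ n * ‖taylorCoeff p n‖) =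
        2 * (p 0).re - ρ ^ n * ‖taylorCoeff p n‖ := by
      have : (2 * p 0 - ρ ^ n * ‖taylorCoeff p n‖ : ℂ) =
        ((2 : ℝ) : ℂ) * p 0 - ((ρ ^ n * ‖taylorCoeff p n‖ : ℝ) : ℂ) := by push_cast; ring
      rw [this, Complex.reCLM_apply, Complex.sub_re, Complex.re_ofReal_mul, Complex.ofReal_re]
    rw [e] at hpos
    linarith
  have hlim : Tendsto (fun ρ : ℝ => ρ ^ n * ‖taylorCoeff p n‖) (𝓝[<] 1)
      (𝓝 (1 ^ n * ‖taylorCoeff p n‖)) := by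
    refine Tendsto.mono_left ?_ nhdsWithin_le_nhds
    exact ((continuous_id.pow n).mul continuous_const).tendsto 1
  rw [one_pow, one_mul] at hlim
  refine le_of_tendsto hlim ?_
  filter_upwards [Ioo_mem_nhdsLT (zero_lt_one' ℝ)] with ρ hρ using main ρ hρ.1 hρ.2

/-- A bounded version of the Carathéodory inequality. -/
lemma norm_taylorCoeff_le_of_norm_le_one {f : ℂ → ℂ} (hf : DifferentiableOn ℂ f disk)
    (hb : ∀ z ∈ disk, ‖f z‖ ≤ 1) {n : ℕ} (hn : n ≠ 0) :
    ‖taylorCoeff f n‖ ≤ 2 * (1 - ‖f 0‖) := by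
  obtain ⟨η, hη, hηf⟩ : ∃ η : ℂ, ‖η‖ = 1 ∧ η * f 0 = -‖f 0‖ := by
    by_cases h : f 0 = 0
    · exact ⟨1, by simp [h]⟩
    · refine ⟨-‖f 0‖ / f 0, ?_, ?_⟩
      · simp [h]
      · field_simp
  have hηd : DifferentiableOn ℂ (fun z => η * f z) disk := hf.const_mul η
  have h := norm_taylorCoeff_le_of_re_nonneg (p := fun z => 1 + η * f z) (hηd.const_add 1)
    (fun z hz => ?_) hn
  · have e : taylorCoeff (fun z => 1 + η * f z) n = η * taylorCoeff f n := by
      rw [taylorCoeff_add (differentiableOn_const 1) hηd, taylorCoeff_const_mul]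
      simp [taylorCoeff, iteratedDeriv_const, hn]
    rw [e, norm_mul, hη, one_mul, hηf] at h
    simpa [sub_eq_add_neg] using h
  · have h1 := Complex.abs_re_le_norm (η * f z)
    rw [norm_mul, hη, one_mul] at h1
    have := (abs_le.mp (h1.trans (hb z hz))).1
    simp only [Complex.add_re, Complex.one_re]
    linarith

/-- **Bohr's theorem** for self-maps of the disk. -/
lemma majorantSum_le_one {f : ℂ → ℂ} (hf : DifferentiableOn ℂ f disk)
    (hb : ∀ z ∈ disk, ‖f z‖ ≤ 1) {r : ℝ} (h0 : 0 ≤ r) (h1 : r ≤ 1 / 3) :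
    majorantSum f r ≤ 1 := by
  have hs := summable_norm_taylorCoeff hf h0 (h1.trans_lt (by norm_num))
  -- At radius `1/3` the tail is at most `2 (1 - |a_0|) (1/3) / (1 - 1/3) = 1 - |a_0|`, exactly what
  -- `a_0` leaves free.
  have hgeo : HasSum (fun n : ℕ => (2 * (1 - ‖f 0‖) * (1 / 3)) * (1 / 3 : ℝ) ^ n)
      ((2 * (1 - ‖f 0‖) * (1 / 3)) * (1 - 1 / 3)⁻¹) :=
    (hasSum_geometric_of_lt_one (by norm_num) (by norm_num)).mul_left _
  rw [majorantSum, hs.tsum_eq_zero_add]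
  have : ∑' n : ℕ, ‖taylorCoeff f (n + 1)‖ * r ^ (n + 1) ≤
      (2 * (1 - ‖f 0‖) * (1 / 3)) * (1 - 1 / 3)⁻¹ := by
    rw [← hgeo.tsum_eq]
    refine ((summable_nat_add_iff 1).mpr hs).tsum_le_tsum (fun n => ?_) hgeo.summable
    have hc := norm_taylorCoeff_le_of_norm_le_one hf hb n.succ_ne_zero
    calc ‖taylorCoeff f (n + 1)‖ * r ^ (n + 1)
        ≤ (2 * (1 - ‖f 0‖)) * (1 / 3) ^ (n + 1) := by
          have : 0 ≤ 2 * (1 - ‖f 0‖) := (norm_nonneg _).trans hc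
          gcongr
      _ = _ := by ring
  rw [taylorCoeff_zero, pow_zero, mul_one]
  norm_num at this ⊢
  linarith

/-! ### The equation `F' = F * Q` and the upper bound for majorants -/

lemma id_mul_dslope {f : ℂ → ℂ} (h0 : f 0 = 0) (z : ℂ) : z * dslope f 0 z = f z := by
  have := sub_smul_dslope f 0 z
  simpa [h0] using this

lemma differentiableOn_dslope_disk {f : ℂ → ℂ} (hf : DifferentiableOn ℂ f disk) :
    DifferentiableOn ℂ (dslope f 0) disk :=
  (Complex.differentiableOn_dslope (disk_mem_nhds zero_mem_disk)).mpr hf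

lemma norm_dslope_le_one {ω : ℂ → ℂ} (hω : DifferentiableOn ℂ ω disk)
    (hm : MapsTo ω disk disk) (h0 : ω 0 = 0) {z : ℂ} (hz : z ∈ disk) : ‖dslope ω 0 z‖ ≤ 1 := by
  have hm' : MapsTo ω (ball 0 1) (closedBall (ω 0) 1) := by
    rw [h0]
    exact fun w hw => ball_subset_closedBall (hm hw)
  simpa using Complex.norm_dslope_le_div_of_mapsTo_ball hω hm' hz

/-- The logarithmic derivative of `f(z) / z` for `f` in `𝒮𝒯_L(s)` with Schwarz function `ω`. -/
def schwarzRate (s : ℝ) (ω : ℂ → ℂ) (z : ℂ) : ℂ :=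
  2 * s * dslope ω 0 z + s ^ 2 * (z * (dslope ω 0 z * dslope ω 0 z))

lemma differentiableOn_schwarzRate (s : ℝ) {ω : ℂ → ℂ} (hω : DifferentiableOn ℂ ω disk) :
    DifferentiableOn ℂ (schwarzRate s ω) disk := by
  have h := differentiableOn_dslope_disk hω
  exact (h.const_mul _).add ((differentiableOn_id.mul (h.mul h)).const_mul _)

lemma id_mul_schwarzRate (s : ℝ) {ω : ℂ → ℂ} (h0 : ω 0 = 0) (z : ℂ) :
    z * schwarzRate s ω z = 2 * s * ω z + s ^ 2 * ω z ^ 2 := by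
  rw [← id_mul_dslope h0 z, schwarzRate]
  ring

/-- A crude bound, used only to see that members of the class are bounded functions. -/
lemma norm_schwarzRate_le {s : ℝ} (hs : 0 ≤ s) {ω : ℂ → ℂ} (hω : DifferentiableOn ℂ ω disk)
    (hm : MapsTo ω disk disk) (h0 : ω 0 = 0) {z : ℂ} (hz : z ∈ disk) :
    ‖schwarzRate s ω z‖ ≤ 2 * s + s ^ 2 := by
  have h1 := norm_dslope_le_one hω hm h0 hz
  have h2 : ‖z‖ ≤ 1 := (mem_disk.mp hz).le
  have h3 : ‖z * (dslope ω 0 z * dslope ω 0 z)‖ ≤ 1 := by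
    rw [norm_mul, norm_mul]
    exact mul_le_one₀ h2 (by positivity) (mul_le_one₀ h1 (norm_nonneg _) h1)
  have e1 : ‖(2 * s : ℂ)‖ = 2 * s := by simp [abs_of_nonneg hs]
  have e2 : ‖((s : ℂ) ^ 2)‖ = s ^ 2 := by simp
  calc ‖schwarzRate s ω z‖ ≤ 2 * s * ‖dslope ω 0 z‖ +
        s ^ 2 * ‖z * (dslope ω 0 z * dslope ω 0 z)‖ := by
        rw [schwarzRate]
        refine (norm_add_le _ _).trans_eq ?_
        rw [norm_mul (2 * s : ℂ), norm_mul ((s : ℂ) ^ 2), e1, e2]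
    _ ≤ 2 * s * 1 + s ^ 2 * 1 := by gcongr
    _ = _ := by ring

lemma majorantSum_schwarzRate_le {s : ℝ} (hs : 0 ≤ s) {ω : ℂ → ℂ}
    (hω : DifferentiableOn ℂ ω disk) (hm : MapsTo ω disk disk) (h0 : ω 0 = 0) {r : ℝ}
    (hr0 : 0 ≤ r) (hr : r ≤ 1 / 3) : majorantSum (schwarzRate s ω) r ≤ 2 * s + s ^ 2 * r := by
  have hr1 : r < 1 := hr.trans_lt (by norm_num)
  have h := differentiableOn_dslope_disk hω
  have hB := majorantSum_le_one h (fun z hz => norm_dslope_le_one hω hm h0 hz) hr0 hr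
  have hB0 := majorantSum_nonneg (dslope ω 0) hr0
  have h2 := majorantSum_mul_le h h hr0 hr1
  have hzz : DifferentiableOn ℂ (fun z => z * (dslope ω 0 z * dslope ω 0 z)) disk :=
    differentiableOn_id.mul (h.mul h)
  have h3 := majorantSum_mul_le (f := fun z => z) differentiableOn_id (h.mul h) hr0 hr1
  rw [majorantSum_id] at h3
  have h4 := majorantSum_add_le (h.const_mul (2 * s : ℂ)) (hzz.const_mul ((s : ℂ) ^ 2)) hr0 hr1
  rw [majorantSum_const_mul, majorantSum_const_mul] at h4
  have e1 : ‖(2 * s : ℂ)‖ = 2 * s := by simp [abs_of_nonneg hs]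
  have e2 : ‖((s : ℂ) ^ 2)‖ = s ^ 2 := by simp
  rw [e1, e2] at h4
  refine h4.trans ?_
  have h5 : majorantSum (fun z => z * (dslope ω 0 z * dslope ω 0 z)) r ≤ r * 1 :=
    h3.trans (mul_le_mul_of_nonneg_left (h2.trans (mul_le_one₀ hB hB0 hB)) hr0)
  calc _ ≤ 2 * s * 1 + s ^ 2 * (r * 1) := by gcongr
    _ = _ := by ring

/-- Since `z f' / f = 1 + z F' / F`, subordination gives the equation after cancelling `z²`. At 0,
where the filled-in quotient carries no information, continuity of both sides extends it. -/
lemma hasDerivAt_dslope_of_logDerivQuot {s : ℝ} {f ω : ℂ → ℂ} (hf : f ∈ classS)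
    (hω : DifferentiableOn ℂ ω disk) (h0 : ω 0 = 0)
    (hsub : ∀ z ∈ disk, logDerivQuot f z = phiL s (ω z)) {z : ℂ} (hz : z ∈ disk) :
    HasDerivAt (dslope f 0) (dslope f 0 z * schwarzRate s ω z) z := by
  obtain ⟨hfd, hinj, hf0, hf1⟩ := hf
  have hFd := differentiableOn_dslope_disk hfd
  have hpunct : ∀ z ∈ disk, z ≠ 0 → deriv (dslope f 0) z = dslope f 0 z * schwarzRate s ω z := by
    intro z hz hz0
    have hfz : f z ≠ 0 := fun h => hz0 (hinj hz zero_mem_disk (h.trans hf0.symm))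
    have hF := (hFd.differentiableAt (disk_mem_nhds hz)).hasDerivAt
    have hd : deriv f z = dslope f 0 z + z * deriv (dslope f 0) z := by
      have h := (hasDerivAt_id z).mul hF
      have e : (id * dslope f 0) = f := funext fun w => id_mul_dslope hf0 w
      rw [e] at h
      simpa using h.deriv
    have h := hsub z hz
    rw [logDerivQuot, Function.update_of_ne hz0, div_eq_iff hfz, hd, phiL,
      ← id_mul_dslope hf0 z] at h
    have hQ := id_mul_schwarzRate s h0 z
    refine mul_left_cancel₀ (mul_ne_zero hz0 hz0) ?_
    linear_combination h - z * dslope f 0 z * hQ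
  have hF := (hFd.differentiableAt (disk_mem_nhds hz)).hasDerivAt
  convert! hF using 1
  by_cases hz0 : z = 0
  · subst hz0
    have c1 : Tendsto (deriv (dslope f 0)) (𝓝[≠] 0) (𝓝 (deriv (dslope f 0) 0)) :=
      ((hFd.deriv isOpen_disk).continuousOn.continuousAt (disk_mem_nhds hz)).mono_left
        nhdsWithin_le_nhds
    have c2 : Tendsto (fun z => dslope f 0 z * schwarzRate s ω z) (𝓝[≠] 0)
        (𝓝 (dslope f 0 0 * schwarzRate s ω 0)) :=
      ((hFd.mul (differentiableOn_schwarzRate s hω)).continuousOn.continuousAt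
        (disk_mem_nhds hz)).mono_left nhdsWithin_le_nhds
    refine tendsto_nhds_unique c2 (c1.congr' ?_)
    filter_upwards [self_mem_nhdsWithin, nhdsWithin_le_nhds (disk_mem_nhds hz)] with w hw0 hw
      using hpunct w hw hw0
  · exact (hpunct z hz hz0).symm

lemma dslope_zero_eq_one {f : ℂ → ℂ} (hf : f ∈ classS) : dslope f 0 0 = 1 := by
  rw [dslope_same, hf.2.2.2]

lemma taylorCoeff_succ_eq_dslope {f : ℂ → ℂ} (hf : f ∈ classS) (n : ℕ) :
    taylorCoeff f (n + 1) = taylorCoeff (dslope f 0) n := by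
  rw [← taylorCoeff_id_mul (differentiableOn_dslope_disk hf.1)]
  exact taylorCoeff_congr (fun z _ => (id_mul_dslope hf.2.2.1 z).symm) _

lemma summable_majorant {f : ℂ → ℂ} (hf : f ∈ classS) {r : ℝ} (h0 : 0 ≤ r) (h1 : r < 1) :
    Summable fun n : ℕ => ‖taylorCoeff f (n + 2)‖ * r ^ (n + 2) :=
  (summable_nat_add_iff 2).mpr (summable_norm_taylorCoeff hf.1 h0 h1)

lemma majorant_eq_majorantSum {f : ℂ → ℂ} (hf : f ∈ classS) {r : ℝ} (h0 : 0 ≤ r) (h1 : r < 1) :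
    majorant f r = majorantSum f r := by
  have hs := summable_norm_taylorCoeff hf.1 h0 h1
  rw [majorantSum, hs.tsum_eq_zero_add, ((summable_nat_add_iff 1).mpr hs).tsum_eq_zero_add,
    taylorCoeff_zero, hf.2.2.1, zero_add, taylorCoeff_one, hf.2.2.2]
  simp [majorant]

lemma majorantSum_eq_mul_dslope {f : ℂ → ℂ} (hf : f ∈ classS) {r : ℝ} (h0 : 0 ≤ r)
    (h1 : r < 1) : majorantSum f r = r * majorantSum (dslope f 0) r := by
  have hs := summable_norm_taylorCoeff hf.1 h0 h1
  rw [majorantSum, hs.tsum_eq_zero_add, taylorCoeff_zero, hf.2.2.1, majorantSum, ← tsum_mul_left]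
  simp only [norm_zero, zero_mul, zero_add, taylorCoeff_succ_eq_dslope hf]
  exact tsum_congr fun n => by ring

/-- The majorant series of the class `𝒮𝒯_L(s)` is dominated by the extremal one up to the Bohr
radius `1/3` of the disk. -/
lemma majorant_le_of_logDerivQuot {s : ℝ} (hs : 0 ≤ s) {f ω : ℂ → ℂ} (hf : f ∈ classS)
    (hω : DifferentiableOn ℂ ω disk) (hm : MapsTo ω disk disk) (h0 : ω 0 = 0)
    (hsub : ∀ z ∈ disk, logDerivQuot f z = phiL s (ω z)) {r : ℝ} (hr0 : 0 ≤ r) (hr : r ≤ 1 / 3) :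
    majorant f r ≤ r * Real.exp (s * (2 * r + s * r ^ 2 / 2)) := by
  have hFd := differentiableOn_dslope_disk hf.1
  set q := majorantSum (dslope f 0) with hq
  have hder : ∀ t ∈ Icc (0 : ℝ) (1 / 3), HasDerivAt q (majorantSum (deriv (dslope f 0)) t) t := by
    intro t ht
    refine hasDerivAt_majorantSum hFd ?_
    rw [abs_of_nonneg ht.1]
    exact ht.2.trans_lt (by norm_num)
  have hle : ∀ t ∈ Icc (0 : ℝ) (1 / 3),
      majorantSum (deriv (dslope f 0)) t ≤ q t * (2 * s + s ^ 2 * t) := by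
    intro t ht
    have ht1 : t < 1 := ht.2.trans_lt (by norm_num)
    rw [majorantSum_congr fun z hz => (hasDerivAt_dslope_of_logDerivQuot hf hω h0 hsub hz).deriv]
    exact (majorantSum_mul_le hFd (differentiableOn_schwarzRate s hω) ht.1 ht1).trans
      (mul_le_mul_of_nonneg_left (majorantSum_schwarzRate_le hs hω hm h0 ht.1 ht.2)
        (majorantSum_nonneg _ ht.1))
  have hexp (t : ℝ) : HasDerivAt (fun t : ℝ => Real.exp (-(s * (2 * t + s * t ^ 2 / 2))))
      (Real.exp (-(s * (2 * t + s * t ^ 2 / 2))) * -(2 * s + s ^ 2 * t)) t := by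
    have h1 : HasDerivAt (fun t : ℝ => -(s * (2 * t + s * t ^ 2 / 2))) (-(2 * s + s ^ 2 * t)) t := by
      convert! ((((hasDerivAt_id t).const_mul 2).add
        (((hasDerivAt_pow 2 t).const_mul s).div_const 2)).const_mul s).neg using 1
      simp
      ring
    exact h1.exp
  -- Grönwall: multiplying by the integrating factor turns `q' ≤ q (2 s + s² t)` into monotonicity,
  -- and `q 0 = 1`.
  have hanti : AntitoneOn (fun t => q t * Real.exp (-(s * (2 * t + s * t ^ 2 / 2))))
      (Icc 0 (1 / 3)) := by
    have hd : ∀ t ∈ Icc (0 : ℝ) (1 / 3), HasDerivAt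
        (fun t => q t * Real.exp (-(s * (2 * t + s * t ^ 2 / 2)))) _ t :=
      fun t ht => (hder t ht).mul (hexp t)
    refine antitoneOn_of_deriv_nonpos (convex_Icc _ _)
      (fun t ht => (hd t ht).continuousAt.continuousWithinAt)
      (fun t ht => (hd t (interior_subset ht)).differentiableAt.differentiableWithinAt) ?_
    intro t ht
    rw [(hd t (interior_subset ht)).deriv]
    have := mul_le_mul_of_nonneg_right (hle t (interior_subset ht))
      (Real.exp_pos (-(s * (2 * t + s * t ^ 2 / 2)))).le
    linarith
  have h := hanti ⟨le_rfl, by norm_num⟩ ⟨hr0, hr⟩ hr0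
  have hq0 : q 0 = 1 := by
    rw [hq, majorantSum, tsum_eq_single 0]
    · simp [taylorCoeff_zero, hf.2.2.2]
    · intro n hn
      simp [hn]
  simp only [hq0, Real.exp_neg] at h
  norm_num at h
  have hr1 : r < 1 := hr.trans_lt (by norm_num)
  rw [majorant_eq_majorantSum hf hr0 hr1, majorantSum_eq_mul_dslope hf hr0 hr1]
  refine mul_le_mul_of_nonneg_left ?_ hr0
  rwa [← div_eq_mul_inv, div_le_one (Real.exp_pos _)] at h

/-! ### Growth theorem and distance to the boundary -/

/-- A lower bound for the real part of a primitive of `schwarzRate`, by inspection of a minimum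
point: there `ω` must be real. -/
lemma le_re_of_hasDerivAt_schwarzRate {s : ℝ} (hs : 0 < s) (hs1 : s < 1) {ω L : ℂ → ℂ}
    (hω : DifferentiableOn ℂ ω disk) (hm : MapsTo ω disk disk) (h0 : ω 0 = 0) (hL0 : L 0 = 0)
    (hL : ∀ z ∈ disk, HasDerivAt L (schwarzRate s ω z) z) {z : ℂ} (hz : z ∈ disk) :
    -(2 * s * ‖z‖) + s ^ 2 * ‖z‖ ^ 2 / 2 ≤ (L z).re := by
  suffices h : ∀ ε > 0, -(2 * s * ‖z‖) + s ^ 2 * ‖z‖ ^ 2 / 2 ≤ (L z).re + ε by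
    exact le_of_forall_pos_le_add h
  intro ε hε
  -- Integrating a pointwise bound along rays would not suffice: once `s ρ > 1/2`, the minimum of
  -- `Re (2 s ω + s² ω²)` over `|ω| = ρ` is not at `-ρ`. At a minimum of `N` only real `ω` matter.
  -- The term `ε ‖w‖` makes the final contradiction strict.
  let N : ℂ → ℝ := fun w => (L w).re + 2 * s * ‖w‖ - s ^ 2 * ‖w‖ ^ 2 / 2 + ε * ‖w‖
  suffices h : 0 ≤ N z by
    have : ε * ‖z‖ ≤ ε * 1 := mul_le_mul_of_nonneg_left (mem_disk.mp hz).le hε.le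
    simp only [N] at h
    linarith
  by_contra! hneg
  have hsub : closedBall (0 : ℂ) ‖z‖ ⊆ disk := closedBall_subset_ball (mem_disk.mp hz)
  have hLc : ContinuousOn L (closedBall (0 : ℂ) ‖z‖) := fun w hw =>
    (hL w (hsub hw)).continuousAt.continuousWithinAt
  have hNc : ContinuousOn N (closedBall (0 : ℂ) ‖z‖) := by
    have := Complex.continuous_re.comp_continuousOn hLc
    exact ((this.add (by fun_prop)).sub (by fun_prop)).add (by fun_prop)
  obtain ⟨w, hw, hmin⟩ := (isCompact_closedBall (0 : ℂ) ‖z‖).exists_isMinOn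
    ⟨z, by simp⟩ hNc
  have hmin' : ∀ v : ℂ, ‖v‖ ≤ ‖z‖ → N w ≤ N v := fun v hv => hmin (by simpa using hv)
  have hwz : ‖w‖ ≤ ‖z‖ := by simpa using hw
  have hwD : w ∈ disk := hsub hw
  have hNw : N w < 0 := (hmin' z le_rfl).trans_lt hneg
  have hw0 : w ≠ 0 := by
    rintro rfl
    simp [N, hL0] at hNw
  have hρ : 0 < ‖w‖ := norm_pos_iff.mpr hw0
  set ρ := ‖w‖ with hρdef
  -- tangential derivative
  have htan : (w * schwarzRate s ω w).im = 0 := by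
    let γ : ℝ → ℂ := fun θ => w * Complex.exp (θ * Complex.I)
    have hγ0 : γ 0 = w := by simp [γ]
    have hγ : HasDerivAt γ (w * Complex.I) 0 := by
      have h1 : HasDerivAt (fun θ : ℝ => (θ : ℂ) * Complex.I) (1 * Complex.I) 0 :=
        (Complex.ofRealCLM.hasDerivAt (x := (0 : ℝ))).mul_const Complex.I
      have h2 := (h1.cexp).const_mul w
      simpa using h2
    have hcomp : HasDerivAt (fun θ => L (γ θ)) (schwarzRate s ω w * (w * Complex.I)) 0 := by
      have h1 : HasDerivAt L (schwarzRate s ω w) (γ 0) := by rw [hγ0]; exact hL w hwD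
      exact h1.comp 0 hγ
    have hre : HasDerivAt (fun θ => (L (γ θ)).re) (schwarzRate s ω w * (w * Complex.I)).re 0 :=
      Complex.reCLM.hasFDerivAt.comp_hasDerivAt 0 hcomp
    have hloc : IsLocalMin (fun θ => (L (γ θ)).re) 0 := by
      refine Eventually.of_forall fun θ => ?_
      have hn : ‖γ θ‖ = ρ := by simp [γ, Complex.norm_exp_ofReal_mul_I, hρdef]
      have := hmin' (γ θ) (by rw [hn]; exact hwz)
      simp only [N, hn, ← hρdef] at this
      simp only [hγ0]
      linarith
    have h := hloc.hasDerivAt_eq_zero hre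
    have e : (schwarzRate s ω w * (w * Complex.I)).re = -(w * schwarzRate s ω w).im := by
      simp
      ring
    rw [e] at h
    linarith
  -- radial derivative
  have hrad : (w * schwarzRate s ω w).re + 2 * s * ρ - s ^ 2 * ρ ^ 2 + ε * ρ ≤ 0 := by
    let ψ : ℝ → ℝ := fun t =>
      (L ((t : ℂ) * w)).re + 2 * s * ρ * t - s ^ 2 * ρ ^ 2 / 2 * t ^ 2 + ε * ρ * t
    have hγ : HasDerivAt (fun t : ℝ => (t : ℂ) * w) (1 * w) 1 :=
      (Complex.ofRealCLM.hasDerivAt (x := (1 : ℝ))).mul_const w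
    have hcomp : HasDerivAt (fun t : ℝ => L ((t : ℂ) * w)) (schwarzRate s ω w * (1 * w)) 1 := by
      have h1 : HasDerivAt L (schwarzRate s ω w) (((1 : ℝ) : ℂ) * w) := by
        rw [Complex.ofReal_one, one_mul]; exact hL w hwD
      exact h1.comp 1 hγ
    have hre : HasDerivAt (fun t : ℝ => (L ((t : ℂ) * w)).re)
        (schwarzRate s ω w * (1 * w)).re 1 :=
      Complex.reCLM.hasFDerivAt.comp_hasDerivAt 1 hcomp
    have hψ : HasDerivAt ψ
        ((w * schwarzRate s ω w).re + 2 * s * ρ - s ^ 2 * ρ ^ 2 + ε * ρ) 1 := by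
      convert! ((hre.add ((hasDerivAt_id (1 : ℝ)).const_mul (2 * s * ρ))).sub
        ((hasDerivAt_pow 2 (1 : ℝ)).const_mul (s ^ 2 * ρ ^ 2 / 2))).add
        ((hasDerivAt_id (1 : ℝ)).const_mul (ε * ρ)) using 1
      rw [one_mul, mul_comm w]
      norm_num
    -- The minimum may lie on the bounding circle, so only slopes from inside are available; they
    -- give the sign.
    have hslope := (hasDerivAt_iff_tendsto_slope.mp hψ).mono_left
      (nhdsWithin_mono 1 (fun t (ht : t ∈ Iio (1 : ℝ)) => ht.ne))
    refine le_of_tendsto hslope ?_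
    filter_upwards [Ioo_mem_nhdsLT (zero_lt_one' ℝ)] with t ht
    have hn : ‖(t : ℂ) * w‖ = t * ρ := by
      rw [norm_mul, Complex.norm_real, Real.norm_eq_abs, abs_of_pos ht.1]
    have h1 := hmin' ((t : ℂ) * w) (by rw [hn]; nlinarith [ht.2])
    have e1 : N ((t : ℂ) * w) = ψ t := by simp only [N, ψ, hn]; ring
    have e2 : N w = ψ 1 := by simp only [N, ψ, ← hρdef, Complex.ofReal_one, one_mul]; ring
    rw [e1, e2] at h1
    rw [slope_def_field]
    exact div_nonpos_of_nonneg_of_nonpos (by linarith) (by linarith [ht.2])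
  have hωn : ‖ω w‖ ≤ ρ := by
    refine Complex.norm_le_norm_of_mapsTo_ball hω
      (fun v hv => ball_subset_closedBall (hm hv)) h0 (mem_disk.mp hwD)
  have hρ1 : ρ < 1 := mem_disk.mp hwD
  rw [id_mul_schwarzRate s h0] at htan hrad
  set x := (ω w).re
  set y := (ω w).im
  have hx : |x| ≤ ρ := (Complex.abs_re_le_norm _).trans hωn
  have him : (2 * s * ω w + (s : ℂ) ^ 2 * ω w ^ 2).im = 2 * s * y * (1 + s * x) := by
    simp [sq, x, y]
    ring
  have hre : (2 * s * ω w + (s : ℂ) ^ 2 * ω w ^ 2).re = 2 * s * x + s ^ 2 * (x ^ 2 - y ^ 2) := by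
    simp [sq, x, y]
  rw [him] at htan
  rw [hre] at hrad
  obtain ⟨hx1, hx2⟩ := abs_le.mp hx
  have h1x : 0 < 1 + s * x := by nlinarith
  have hy : y = 0 := by
    have := (mul_eq_zero.mp htan).resolve_right h1x.ne'
    exact (mul_eq_zero.mp this).resolve_left (by positivity)
  rw [hy] at hrad
  -- This product is the radial derivative without its `ε` term, once `y = 0`.
  have : 0 ≤ (x + ρ) * (s * (2 + s * (x - ρ))) := by
    refine mul_nonneg (by linarith) (mul_nonneg hs.le ?_)
    nlinarith
  nlinarith [mul_pos hε hρ]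

/-- `Q` has a primitive `L` on the disk, and `F * exp (-L)` has derivative 0. -/
lemma exists_log_dslope {s : ℝ} {f ω : ℂ → ℂ} (hf : f ∈ classS)
    (hω : DifferentiableOn ℂ ω disk) (h0 : ω 0 = 0)
    (hsub : ∀ z ∈ disk, logDerivQuot f z = phiL s (ω z)) :
    ∃ L : ℂ → ℂ, L 0 = 0 ∧ (∀ z ∈ disk, HasDerivAt L (schwarzRate s ω z) z) ∧
      ∀ z ∈ disk, f z = z * Complex.exp (L z) := by
  obtain ⟨L, hL0, hL⟩ :=
    (DifferentiableOn.isExactOn_ball (differentiableOn_schwarzRate s hω)).with_val_at 0 0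
  refine ⟨L, hL0, hL, fun z hz => ?_⟩
  have hd : ∀ z ∈ disk, HasDerivAt (fun z => dslope f 0 z * Complex.exp (-L z)) 0 z := by
    intro z hz
    convert! (hasDerivAt_dslope_of_logDerivQuot hf hω h0 hsub hz).mul (hL z hz).neg.cexp using 1
    ring
  have hc := isOpen_disk.is_const_of_deriv_eq_zero (convex_ball _ _).isPreconnected
    (fun z hz => (hd z hz).differentiableAt.differentiableWithinAt)
    (fun z hz => (hd z hz).deriv) hz zero_mem_disk
  simp only [dslope_zero_eq_one hf, hL0, neg_zero, Complex.exp_zero, mul_one, Complex.exp_neg,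
    ← div_eq_mul_inv] at hc
  rw [div_eq_one_iff_eq (Complex.exp_ne_zero _)] at hc
  rw [← id_mul_dslope hf.2.2.1 z, hc]

lemma isOpen_image_of_mem_classS {f : ℂ → ℂ} (hf : f ∈ classS) {U : Set ℂ} (hU : U ⊆ disk)
    (hUo : IsOpen U) : IsOpen (f '' U) := by
  refine (((hf.1.analyticOnNhd isOpen_disk).is_constant_or_isOpen
    (convex_ball _ _).isPreconnected).resolve_left ?_) U hU hUo
  rintro ⟨w, hw⟩
  have h2 : (1 / 2 : ℂ) ∈ disk := by norm_num [mem_disk]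
  have := hf.2.1 h2 zero_mem_disk ((hw _ h2).trans (hw _ zero_mem_disk).symm)
  norm_num at this

lemma le_boundaryDist {f : ℂ → ℂ} (hf : f ∈ classS) {c B : ℝ} (hc : 0 ≤ c)
    (hlow : ∀ z ∈ disk, c * ‖z‖ ≤ ‖f z‖) (hup : ∀ z ∈ disk, ‖f z‖ ≤ B) :
    c ≤ boundaryDist f := by
  have hopen : IsOpen (f '' disk) := isOpen_image_of_mem_classS hf Subset.rfl isOpen_disk
  -- `infDist` to the empty set is 0 by convention, so the frontier must be nonempty; the bound `B`
  -- serves only this.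
  have hne : (frontier (f '' disk)).Nonempty := by
    refine nonempty_frontier_iff.mpr ⟨⟨f 0, mem_image_of_mem f zero_mem_disk⟩, fun h => ?_⟩
    have hB : 0 ≤ B := (norm_nonneg _).trans (hup 0 zero_mem_disk)
    obtain ⟨z, hz, hzB⟩ : ((B + 1 : ℝ) : ℂ) ∈ f '' disk := h ▸ mem_univ _
    have := hup z hz
    rw [hzB, Complex.norm_real, Real.norm_eq_abs, abs_of_pos (by linarith)] at this
    linarith
  refine (le_infDist hne).mpr fun w hw => ?_
  rw [hf.2.2.1, dist_zero_left]
  have hwn : w ∉ f '' disk := fun h => by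
    rw [hopen.frontier_eq] at hw
    exact hw.2 h
  have main : ∀ ρ : ℝ, ρ < 1 → c * ρ ≤ ‖w‖ := by
    intro ρ hρ
    have hsub : closedBall (0 : ℂ) ρ ⊆ disk := closedBall_subset_ball hρ
    have hcpt : IsClosed (f '' closedBall 0 ρ) :=
      ((isCompact_closedBall _ _).image_of_continuousOn (hf.1.continuousOn.mono hsub)).isClosed
    have hcl : IsClosed {v : ℂ | c * ρ ≤ ‖v‖} := isClosed_le continuous_const continuous_norm
    -- Both sets on the right are closed, so a frontier point lies in one of them. It is not in the
    -- open image, which excludes the first.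
    have hcov : f '' disk ⊆ f '' closedBall 0 ρ ∪ {v : ℂ | c * ρ ≤ ‖v‖} := by
      rintro _ ⟨z, hz, rfl⟩
      by_cases h : ‖z‖ ≤ ρ
      · exact Or.inl ⟨z, by simpa using h, rfl⟩
      · exact Or.inr ((mul_le_mul_of_nonneg_left (not_le.mp h).le hc).trans (hlow z hz))
    rcases closure_minimal hcov (hcpt.union hcl) (frontier_subset_closure hw) with h | h
    · exact absurd (image_mono hsub h) hwn
    · exact h
  have hlim : Tendsto (fun ρ : ℝ => c * ρ) (𝓝[<] 1) (𝓝 (c * 1)) :=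
    ((continuous_const.mul continuous_id).tendsto 1).mono_left nhdsWithin_le_nhds
  rw [mul_one] at hlim
  exact le_of_tendsto hlim (by filter_upwards [self_mem_nhdsWithin] with ρ hρ using main ρ hρ)

/-- The growth theorem for `𝒮𝒯_L(s)`, at the boundary. -/
lemma exp_le_boundaryDist {s : ℝ} (hs : 0 < s) (hs1 : s < 1) {f : ℂ → ℂ} (hf : f ∈ classSTL s) :
    Real.exp (-(2 * s) + s ^ 2 / 2) ≤ boundaryDist f := by
  obtain ⟨hS, ω, hω, hm, h0, hsub⟩ := hf
  obtain ⟨L, hL0, hL, hfL⟩ := exists_log_dslope hS hω h0 hsub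
  refine le_boundaryDist (B := Real.exp (2 * s + s ^ 2)) hS (Real.exp_pos _).le
    (fun z hz => ?_) (fun z hz => ?_)
  · have h := le_re_of_hasDerivAt_schwarzRate hs hs1 hω hm h0 hL0 hL hz
    have hz1 : ‖z‖ < 1 := mem_disk.mp hz
    rw [hfL z hz, norm_mul, Complex.norm_exp, mul_comm]
    refine mul_le_mul_of_nonneg_left (Real.exp_le_exp.mpr (le_trans ?_ h)) (norm_nonneg _)
    have : 0 ≤ s * ((1 - ‖z‖) * (2 - s * (1 + ‖z‖) / 2)) := by
      refine mul_nonneg hs.le (mul_nonneg (by linarith) ?_)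
      nlinarith [norm_nonneg z]
    nlinarith
  · have hz1 : ‖z‖ < 1 := mem_disk.mp hz
    have h := (convex_ball (0 : ℂ) 1).norm_image_sub_le_of_norm_hasDerivWithin_le
      (fun w hw => (hL w hw).hasDerivWithinAt)
      (fun w hw => norm_schwarzRate_le hs.le hω hm h0 hw) zero_mem_disk hz
    rw [hL0, sub_zero, sub_zero] at h
    rw [hfL z hz, norm_mul, Complex.norm_exp]
    have h2 : (L z).re ≤ 2 * s + s ^ 2 := by
      refine (Complex.re_le_norm _).trans (h.trans ?_)
      exact mul_le_of_le_one_right (by positivity) hz1.le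
    calc ‖z‖ * Real.exp (L z).re ≤ 1 * Real.exp (2 * s + s ^ 2) := by gcongr
      _ = _ := one_mul _

/-! ### Univalence of `h` and its boundary point `h(-1)` -/

/-- A **Noshiro–Warschawski** criterion: a function whose derivative has positive real part on a
convex set is injective there. -/
lemma injOn_of_re_hasDerivAt_pos {F F' : ℂ → ℂ} {H : Set ℂ} (hH : Convex ℝ H)
    (hF : ∀ w ∈ H, HasDerivAt F (F' w) w) (hpos : ∀ w ∈ H, 0 < (F' w).re) : InjOn F H := by
  intro a ha b hb hab
  by_contra hne
  have hmem : ∀ t ∈ Icc (0 : ℝ) 1, a + (t : ℂ) * (b - a) ∈ H := fun t ht => by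
    simpa using hH.add_smul_sub_mem ha hb ht
  -- Rolle: `ψ` agrees at both ends, yet its derivative is `|b - a|² Re F' > 0`.
  let ψ : ℝ → ℝ := fun t => (F (a + (t : ℂ) * (b - a)) * (starRingEnd ℂ) (b - a)).re
  have hψ : ∀ t ∈ Icc (0 : ℝ) 1, HasDerivAt ψ
      (F' (a + (t : ℂ) * (b - a)) * (1 * (b - a)) * (starRingEnd ℂ) (b - a)).re t := by
    intro t ht
    have h1 : HasDerivAt (fun t : ℝ => a + (t : ℂ) * (b - a)) (1 * (b - a)) t :=
      ((Complex.ofRealCLM.hasDerivAt (x := t)).mul_const (b - a)).const_add a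
    have h2 : HasDerivAt (fun t : ℝ => F (a + (t : ℂ) * (b - a)))
        (F' (a + (t : ℂ) * (b - a)) * (1 * (b - a))) t := (hF _ (hmem t ht)).comp t h1
    exact Complex.reCLM.hasFDerivAt.comp_hasDerivAt t (h2.mul_const _)
  obtain ⟨t, ht, h⟩ := exists_hasDerivAt_eq_zero (zero_lt_one' ℝ)
    (fun t ht => (hψ t ht).continuousAt.continuousWithinAt)
    (by simp [ψ, hab]) (fun t ht => hψ t (Ioo_subset_Icc_self ht))
  rw [one_mul, mul_assoc, Complex.mul_conj, mul_comm, Complex.re_ofReal_mul] at h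
  refine (mul_pos (Complex.normSq_pos.mpr (sub_ne_zero.mpr (Ne.symm hne)))
    (hpos _ (hmem t (Ioo_subset_Icc_self ht)))).ne' h

/-- With `y² < 1 - x²`, the real part exceeds `2 (s x + 1/2)² + 1/2 - s²`; hence the threshold
`1/√2`. -/
lemma re_phiL_pos {s : ℝ} (hs : 0 < s) (hs2 : s ^ 2 ≤ 1 / 2) {z : ℂ} (hz : z ∈ disk) :
    0 < (phiL s z).re := by
  have h : Complex.normSq z < 1 := by
    rw [Complex.normSq_eq_norm_sq]
    nlinarith [mem_disk.mp hz, norm_nonneg z]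
  rw [Complex.normSq_apply] at h
  have e : (phiL s z).re = (1 + s * z.re) ^ 2 - s ^ 2 * z.im ^ 2 := by
    simp [phiL, sq]
    ring
  rw [e]
  nlinarith [sq_nonneg (s * z.re + 1 / 2), mul_pos (mul_pos hs hs) (sub_pos.mpr h)]

lemma hL_zero (s : ℝ) : hL s 0 = 0 := by simp [hL]

lemma hasDerivAt_hL (s : ℝ) (z : ℂ) :
    HasDerivAt (hL s) (Complex.exp ((s : ℂ) * (2 * z + (s : ℂ) * z ^ 2 / 2)) * phiL s z) z := by
  have h1 : HasDerivAt (fun z : ℂ => (s : ℂ) * (2 * z + (s : ℂ) * z ^ 2 / 2))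
      (s * (2 + s * z)) z := by
    convert! (((hasDerivAt_id z).const_mul 2).add
      (((hasDerivAt_pow 2 z).const_mul (s : ℂ)).div_const 2)).const_mul (s : ℂ) using 1
    simp
    exact Or.inl (by ring)
  convert! (hasDerivAt_id z).mul h1.cexp using 1
  simp only [phiL, id]
  ring

lemma differentiable_hL (s : ℝ) : Differentiable ℂ (hL s) :=
  fun z => (hasDerivAt_hL s z).differentiableAt

/-- In the coordinate `z = exp w` the map becomes `F = log h(exp w)` on the left half-plane, with
`F' = φ(exp w)` of positive real part. Translation by `2πi n` commutes with `F`, which absorbs the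
ambiguity of the logarithm. -/
lemma injOn_hL {s : ℝ} (hs : 0 < s) (hs2 : s ^ 2 ≤ 1 / 2) : InjOn (hL s) disk := by
  let F : ℂ → ℂ := fun w =>
    w + (s : ℂ) * (2 * Complex.exp w + (s : ℂ) * Complex.exp w ^ 2 / 2)
  have hexpF (w : ℂ) : Complex.exp (F w) = hL s (Complex.exp w) := by
    simp only [F, hL, Complex.exp_add]
  have hper (w : ℂ) (n : ℤ) : F (w + n * (2 * Real.pi * Complex.I)) =
      F w + n * (2 * Real.pi * Complex.I) := by
    have : Complex.exp (w + n * (2 * Real.pi * Complex.I)) = Complex.exp w :=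
      Complex.exp_eq_exp_iff_exists_int.mpr ⟨n, rfl⟩
    simp only [F, this]
    ring
  have hFd (w : ℂ) : HasDerivAt F (phiL s (Complex.exp w)) w := by
    convert! (hasDerivAt_id w).add ((((Complex.hasDerivAt_exp w).const_mul 2).add
      ((((Complex.hasDerivAt_exp w).pow 2).const_mul (s : ℂ)).div_const 2)).const_mul (s : ℂ))
      using 1
    simp only [phiL]
    norm_num
    ring
  have hexp {w : ℂ} (hw : w ∈ {w : ℂ | w.re < 0}) : Complex.exp w ∈ disk := by
    rw [mem_disk, Complex.norm_exp, ← Real.exp_zero]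
    exact Real.exp_lt_exp.mpr hw
  have hinj : InjOn F {w : ℂ | w.re < 0} :=
    injOn_of_re_hasDerivAt_pos (convex_halfSpace_re_lt 0) (fun w _ => hFd w)
      (fun w hw => re_phiL_pos hs hs2 (hexp hw))
  have hlog {z : ℂ} (hz : z ∈ disk) (hz0 : z ≠ 0) : (Complex.log z).re < 0 := by
    rw [Complex.log_re]
    exact Real.log_neg (norm_pos_iff.mpr hz0) (mem_disk.mp hz)
  have hzero {z : ℂ} (h : hL s z = 0) : z = 0 :=
    (mul_eq_zero.mp h).resolve_right (Complex.exp_ne_zero _)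
  intro z₁ h₁ z₂ h₂ h
  by_cases hz₁ : z₁ = 0
  · rw [hz₁, hL_zero] at h
    rw [hz₁, hzero h.symm]
  by_cases hz₂ : z₂ = 0
  · rw [hz₂, hL_zero] at h
    rw [hz₂, hzero h]
  have hE : Complex.exp (F (Complex.log z₁)) = Complex.exp (F (Complex.log z₂)) := by
    rw [hexpF, hexpF, Complex.exp_log hz₁, Complex.exp_log hz₂, h]
  obtain ⟨n, hn⟩ := Complex.exp_eq_exp_iff_exists_int.mp hE
  rw [← hper] at hn
  have hw := hinj (hlog h₁ hz₁) (by simpa using hlog h₂ hz₂) hn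
  rw [← Complex.exp_log hz₁, ← Complex.exp_log hz₂]
  exact Complex.exp_eq_exp_iff_exists_int.mpr ⟨n, hw⟩

lemma hL_mem_classS {s : ℝ} (hs : 0 < s) (hs2 : s ^ 2 ≤ 1 / 2) : hL s ∈ classS :=
  ⟨(differentiable_hL s).differentiableOn, injOn_hL hs hs2, hL_zero s, by
    rw [(hasDerivAt_hL s 0).deriv]; simp [phiL]⟩

lemma logDerivQuot_hL (s : ℝ) (z : ℂ) : logDerivQuot (hL s) z = phiL s z := by
  by_cases hz : z = 0
  · simp [hz, logDerivQuot, phiL]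
  · rw [logDerivQuot, Function.update_of_ne hz, (hasDerivAt_hL s z).deriv, hL]
    have := Complex.exp_ne_zero ((s : ℂ) * (2 * z + (s : ℂ) * z ^ 2 / 2))
    field_simp

lemma hL_mem_classSTL {s : ℝ} (hs : 0 < s) (hs2 : s ^ 2 ≤ 1 / 2) : hL s ∈ classSTL s :=
  ⟨hL_mem_classS hs hs2, id, differentiableOn_id, fun _ hz => hz, rfl,
    fun z _ => logDerivQuot_hL s z⟩

lemma hL_ofReal (s r : ℝ) :
    hL s (r : ℂ) = ((r * Real.exp (s * (2 * r + s * r ^ 2 / 2)) : ℝ) : ℂ) := by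
  simp [hL]

lemma hL_neg_one (s : ℝ) : hL s (-1) = ((-Real.exp (-(2 * s) + s ^ 2 / 2) : ℝ) : ℂ) := by
  have : ((-1 : ℝ) : ℂ) = -1 := by simp
  rw [← this, hL_ofReal, neg_one_mul]
  congr 3
  ring

/-- If `h(z) = h(-1)` with `|z| < ρ < 1`, the open set `h(ball 0 ρ)` contains `h(-r)` for `r` near
1, against injectivity in the disk. -/
lemma hL_neg_one_notMem_image {s : ℝ} (hs : 0 < s) (hs2 : s ^ 2 ≤ 1 / 2) :
    hL s (-1) ∉ hL s '' disk := by
  rintro ⟨z, hz, hzh⟩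
  obtain ⟨ρ, hzρ, hρ1⟩ := exists_between (mem_disk.mp hz)
  have hU : ball (0 : ℂ) ρ ⊆ disk := ball_subset_ball hρ1.le
  have hnhds : hL s '' ball 0 ρ ∈ 𝓝 (hL s (-1)) :=
    (isOpen_image_of_mem_classS (hL_mem_classS hs hs2) hU isOpen_ball).mem_nhds
      ⟨z, by simpa using hzρ, hzh⟩
  have hcont : Tendsto (fun r : ℝ => hL s (-(r : ℂ))) (𝓝[<] 1) (𝓝 (hL s (-1))) := by
    have h : Continuous fun r : ℝ => hL s (-(r : ℂ)) :=
      (differentiable_hL s).continuous.comp Complex.continuous_ofReal.neg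
    have := h.tendsto 1
    rw [Complex.ofReal_one] at this
    exact this.mono_left nhdsWithin_le_nhds
  have hρ0 : 0 ≤ ρ := (norm_nonneg z).trans hzρ.le
  obtain ⟨r, ⟨v, hv, hvr⟩, hr⟩ :=
    ((hcont.eventually hnhds).and (Ioo_mem_nhdsLT hρ1)).exists
  have hrn : ‖-(r : ℂ)‖ = r := by simp [abs_of_nonneg (hρ0.trans hr.1.le)]
  have := injOn_hL hs hs2 (hU hv) (by rw [mem_disk, hrn]; exact hr.2) hvr
  rw [mem_ball_zero_iff, this, hrn] at hv
  exact lt_asymm hv hr.1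

lemma boundaryDist_hL_le {s : ℝ} (hs : 0 < s) (hs2 : s ^ 2 ≤ 1 / 2) :
    boundaryDist (hL s) ≤ Real.exp (-(2 * s) + s ^ 2 / 2) := by
  have hmem : hL s (-1) ∈ frontier (hL s '' disk) := by
    rw [(isOpen_image_of_mem_classS (hL_mem_classS hs hs2) Subset.rfl isOpen_disk).frontier_eq]
    refine ⟨image_closure_subset_closure_image (differentiable_hL s).continuous ⟨-1, ?_, rfl⟩,
      hL_neg_one_notMem_image hs hs2⟩
    rw [disk, closure_ball _ one_ne_zero]
    simp
  refine (infDist_le_dist_of_mem hmem).trans_eq ?_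
  rw [hL_zero, dist_zero_left, hL_neg_one, Complex.norm_real, norm_neg, Real.norm_eq_abs,
    Real.abs_exp]

/-! ### Location of the root and conclusion -/

lemma strictMonoOn_mul_exp {s : ℝ} (hs : 0 ≤ s) :
    StrictMonoOn (fun r : ℝ => r * Real.exp (s * (2 * r + s * r ^ 2 / 2))) (Ici 0) := by
  intro a ha b hb hab
  have ha0 : 0 ≤ a := ha
  refine mul_lt_mul hab (Real.exp_le_exp.mpr ?_) (Real.exp_pos _) hb
  gcongr

/-- Taking logarithms, the claim is `log 3 < 8 s / 3 - 4 s² / 9`; `0.444981` is the crossing point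
rounded up. -/
lemma exp_lt_third_mul_exp {s : ℝ} (hs : 0.444981 < s) (hs1 : s < 1) :
    Real.exp (-(2 * s) + s ^ 2 / 2) <
      1 / 3 * Real.exp (s * (2 * (1 / 3) + s * (1 / 3) ^ 2 / 2)) := by
  have h3 : (1 / 3 : ℝ) = Real.exp (-Real.log 3) := by
    rw [Real.exp_neg, Real.exp_log (by norm_num)]
    norm_num
  nth_rewrite 1 [h3]
  rw [← Real.exp_add, Real.exp_lt_exp]
  have := Real.log_three_lt_d9
  nlinarith [mul_pos (sub_pos.mpr hs) (sub_pos.mpr hs1)]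

end BohrStarlike

end

theorem corollary2p9 (s : ℝ) (hs : 0.444981 < s) (hs' : s ≤ 1 / Real.sqrt 2) :
    -- `h` is the Ma-Minda extremal function of the class: `h ∈ 𝒮` and `z h'(z) / h(z) = φ(z)`
    (BohrStarlike.hL s ∈ BohrStarlike.classSTL s ∧
      ∀ z ∈ BohrStarlike.disk, BohrStarlike.logDerivQuot (BohrStarlike.hL s) z =
        BohrStarlike.phiL s z) ∧
    ∃ rf : ℝ,
      -- `rf` is the smallest root in `(0, 1)` of `h(r) + h(-1) = 0`, and `rf < 1/3`
      IsLeast {r : ℝ | r ∈ Set.Ioo (0 : ℝ) 1 ∧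
        BohrStarlike.hL s (r : ℂ) + BohrStarlike.hL s (-1) = 0} rf ∧
      rf < 1 / 3 ∧
      -- the Bohr inequality holds for `|z| ≤ rf`
      (∀ f ∈ BohrStarlike.classSTL s, ∀ z : ℂ, ‖z‖ ≤ rf →
        Summable (fun n : ℕ => ‖BohrStarlike.taylorCoeff f (n + 2)‖ * ‖z‖ ^ (n + 2)) ∧
        BohrStarlike.majorant f ‖z‖ ≤ BohrStarlike.boundaryDist f) ∧
      -- `rf` cannot be replaced by any larger radius
      (∀ r : ℝ, rf < r → r < 1 → ∃ f ∈ BohrStarlike.classSTL s, ∀ z : ℂ, ‖z‖ = r →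
        Summable (fun n : ℕ => ‖BohrStarlike.taylorCoeff f (n + 2)‖ * ‖z‖ ^ (n + 2)) ∧
        BohrStarlike.boundaryDist f < BohrStarlike.majorant f ‖z‖) := by
  have hs0 : 0 < s := lt_trans (by norm_num) hs
  have hs2 : s ^ 2 ≤ 1 / 2 := by
    calc s ^ 2 ≤ (1 / Real.sqrt 2) ^ 2 := by gcongr
      _ = 1 / 2 := by rw [div_pow, one_pow, Real.sq_sqrt (by norm_num)]
  have hs1 : s < 1 := by nlinarith
  have hmem := BohrStarlike.hL_mem_classSTL hs0 hs2
  refine ⟨⟨hmem, fun z _ => BohrStarlike.logDerivQuot_hL s z⟩, ?_⟩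
  set u : ℝ → ℝ := fun r => r * Real.exp (s * (2 * r + s * r ^ 2 / 2)) with hu
  have hmono : StrictMonoOn u (Set.Ici 0) := BohrStarlike.strictMonoOn_mul_exp hs0.le
  have hroot : ∀ r : ℝ, BohrStarlike.hL s (r : ℂ) + BohrStarlike.hL s (-1) = 0 ↔
      u r = Real.exp (-(2 * s) + s ^ 2 / 2) := by
    intro r
    rw [BohrStarlike.hL_ofReal, BohrStarlike.hL_neg_one, ← Complex.ofReal_add,
      Complex.ofReal_eq_zero, ← sub_eq_add_neg, sub_eq_zero]
  have hcont : ContinuousOn u (Set.Icc 0 (1 / 3)) := by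
    rw [hu]
    fun_prop
  obtain ⟨rf, hrf, hrfu⟩ := intermediate_value_Ioo (by norm_num) hcont
    (show Real.exp (-(2 * s) + s ^ 2 / 2) ∈ Set.Ioo (u 0) (u (1 / 3)) from
      ⟨by simp [hu, Real.exp_pos], BohrStarlike.exp_lt_third_mul_exp hs hs1⟩)
  refine ⟨rf, ⟨⟨⟨hrf.1, hrf.2.trans (by norm_num)⟩, (hroot rf).mpr hrfu⟩, fun r hr => ?_⟩,
    hrf.2, fun f hf z hz => ?_, fun r hr hr1 => ⟨_, hmem, fun z hz => ?_⟩⟩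
  -- Strict monotonicity of `u` makes the root unique, hence least.
  · exact (hmono.injOn hrf.1.le hr.1.1.le (hrfu.trans ((hroot r).mp hr.2).symm)).le
  · have hz3 : ‖z‖ ≤ 1 / 3 := hz.trans hrf.2.le
    refine ⟨BohrStarlike.summable_majorant hf.1 (norm_nonneg z) (hz3.trans_lt (by norm_num)), ?_⟩
    refine le_trans ?_ (BohrStarlike.exp_le_boundaryDist hs0 hs1 hf)
    obtain ⟨hS, ω, hω, hm, h0, hsub⟩ := hf
    refine (BohrStarlike.majorant_le_of_logDerivQuot hs0.le hS hω hm h0 hsub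
      (norm_nonneg z) hz3).trans ?_
    rw [← hrfu]
    exact hmono.monotoneOn (norm_nonneg z) hrf.1.le hz
  · have hr0 : 0 ≤ r := hrf.1.le.trans hr.le
    rw [hz]
    refine ⟨BohrStarlike.summable_majorant hmem.1 hr0 hr1, ?_⟩
    refine (BohrStarlike.boundaryDist_hL_le hs0 hs2).trans_lt ?_
    rw [← hrfu, BohrStarlike.majorant_eq_majorantSum hmem.1 hr0 hr1]
    -- Beyond `rf`, `u r` exceeds `-h(-1)`, and the majorant of `h` dominates `|h(r)| = u r`. No
    -- bound `r ≤ 1/3` is needed here.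
    refine (hmono hrf.1.le hr0 hr).trans_le ?_
    have hrn : ‖(r : ℂ)‖ = r := by rw [Complex.norm_real, Real.norm_eq_abs, abs_of_nonneg hr0]
    have h := BohrStarlike.norm_le_majorantSum hmem.1.1
      (z := (r : ℂ)) (by rw [BohrStarlike.mem_disk, hrn]; exact hr1)
    rw [hrn, BohrStarlike.hL_ofReal, Complex.norm_real] at h
    exact (le_abs_self _).trans h
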